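/- Let $A$ be a compact (Hausdorff) abelian topological group, written additively, with Haar measure $H$ normalized by $H(A)=1$, and let $L^2(A)=L^2(A,H;\mathbf C)$ with $\langle f,g\rangle=\int_A f\,\overline g\,dH$. A character is a continuous homomorphism $\phi:A\to\mathbf T$; $\widehat A$ is the group of characters. Put $\widehat\theta(\phi)=\int_A\theta\,\overline\phi\,dH$ for $\theta\in L^1(A)$, $\widehat\mu(\phi)=\int_A\overline\phi\,d\mu$ for a complex regular Borel measure $\mu$ on $A$, $(T_af)(x)=f(x+a)$ for $a\in A$, $f\in L^2(A)$, and $(\theta*f)(x)=\int_A\theta(y)f(x-y)\,dH(y)$. 1. Each $T_a$ is a unitary operator on $L^2(A)$, and $T_a\phi=\phi(a)\phi$ for every $\phi\in\widehat A$. 2. For every $\theta\in L^1(A)$ and $f\in L^2(A)$ the integral defining $(\theta*f)(x)$ exists for almost every $x$, and $C_\theta f=\theta*f$ defines a bounded linear operator on $L^2(A)$ with $\|C_\theta\|\le\|\theta\|_{L^1}$. Moreover: (a) $C_\theta^*=C_{\widetilde\theta}$ with $\widetilde\theta(x)=\overline{\theta(-x)}$; (b) $C_\theta$ is a compact operator and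 a limit in operator norm of finite rank operators, and it is normal; $L^2(A)$ has an orthonormal basis consisting of eigenvectors of $C_\theta$; (c) $T_a$ commutes with $C_\theta$ for every $a\in A$, and $T_a(E(\lambda,\theta))=E(\lambda,\theta)$ for every $a\in A$ and $\lambda\in\mathbf C$, where $E(\lambda,\theta)=\{f\in L^2(A):C_\theta f=\lambda f\}$; (d) $C_\theta\phi=\widehat\theta(\phi)\,\phi$ for every $\phi\in\widehat A$; (e) for every $\lambda\ne0$, $E(\lambda,\theta)$ is finite-dimensional and has an orthonormal basis consisting of characters. 3. If $f\in L^2(A)$, $f\neq0$, and for each $a\in A$ there is $m(a)\in\mathbf C$ with $T_af=m(a)f$, then $m$ is a character of $A$ and $f$ is a constant multiple of $m$ almost everywhere. 4. The characters of $A$ form an orthonormal basis of $L^2(A)$. 5. Finite linear combinations of characters are dense in $C(A)$ (complex-valued continuous functions) with respect to the supremum norm. 6. If $\theta\in L^1(A)$ and $\widehat\theta(\phi)=0$ for every $\phi\in\widehat A$, then $\theta=0$ almost everywhere. 7. If $\mu$ is a complex regular Borel measure on $A$ (that is, its total variation measure $|\mu|$ is regular) and $\widehat\mu(\phi)=0$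 for every $\phi\in\widehat A$, then $\mu=0$. -/

import Mathlib

open MeasureTheory
open scoped ENNReal ComplexConjugate

namespace CompactFourier

variable (A : Type*) [AddCommGroup A] [TopologicalSpace A]

/-- The dual group of an additively written topological group `A`: the continuous homomorphisms
from `A` into the unit circle, i.e. the Pontryagin dual of `A` written multiplicatively. -/
abbrev DualGroup := PontryaginDual (Multiplicative A)

variable {A}

/-- The value `φ(x)` of a character, as a complex number. -/
noncomputable def charVal (φ : DualGroup A) (x : A) : ℂ := (φ (Multiplicative.ofAdd x) : ℂ)

theorem continuous_charVal (φ : DualGroup A) : Continuous (charVal φ) :=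
  continuous_subtype_val.comp ((map_continuous φ).comp continuous_ofAdd)

/-- A character, as a continuous complex-valued function on `A`. -/
noncomputable def charC (φ : DualGroup A) : C(A, ℂ) := ⟨charVal φ, continuous_charVal φ⟩

variable [MeasurableSpace A] [BorelSpace A]

/-- The Fourier transform `θ̂(φ) = ∫ θ(x) conj(φ(x)) dH(x)` of a function `θ`. -/
noncomputable def fourierFun (H : Measure A) (θ : A → ℂ) (φ : DualGroup A) : ℂ :=
  ∫ x, θ x * conj (charVal φ x) ∂H

/-- The Fourier transform `μ̂(φ) = ∫ conj(φ(x)) dμ(x)` of a complex Borel measure `μ`. -/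
noncomputable def fourierMeasure (μ : ComplexMeasure A) (φ : DualGroup A) : ℂ :=
  VectorMeasure.integral μ (fun x => conj (charVal φ x)) (ContinuousLinearMap.mul ℝ ℂ)

/-- A character, as an element of `L²(A)`. -/
noncomputable def charL2 [CompactSpace A] (H : Measure A) [IsFiniteMeasure H]
    (φ : DualGroup A) : Lp ℂ 2 H :=
  ContinuousMap.toLp 2 H ℂ (charC φ)

/-- The translation operator `(T_a f)(x) = f(x + a)` on `L²(A)`. -/
noncomputable def translation [IsTopologicalAddGroup A] (H : Measure A) [H.IsAddHaarMeasure]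
    (a : A) : Lp ℂ 2 H →L[ℂ] Lp ℂ 2 H :=
  (Lp.compMeasurePreservingₗᵢ ℂ (fun x : A => x + a)
    (measurePreserving_add_right H a)).toContinuousLinearMap

/-- The convolution `(θ * f)(x) = ∫ θ(y) f(x - y) dH(y)`. -/
noncomputable def conv (H : Measure A) (θ f : A → ℂ) : A → ℂ :=
  convolution θ f (ContinuousLinearMap.mul ℂ ℂ) H

end CompactFourier

/-! Convolution is written as an average of translations, the Bochner integral `∫ θ(y) T_{-y}
dH(y)`. Adjoints, normality, commutation with translations and the action on characters then follow
from the same facts for the commuting unitaries `T_a`. For `u` in `L²`, `u * f = f * u = ∫ f(y)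
T_{-y}u dH(y)`, and the orbit of `u` is compact; a simple function uniformly close to the orbit map
gives a finite rank operator close to `C_u`. The bound by the `L¹` norm extends this to all
integrable `θ`. Eigenspaces for nonzero eigenvalues are therefore finite-dimensional and translation
invariant, and such a space is spanned by its characters (`span_charL2_eq`). By the spectral
theorem, an `f` orthogonal to all characters is killed by every convolution operator, and this
forces `f = 0` (`eq_zero_of_convOp_eq_zero`). So the characters are complete in `L²`, hence separate
points; Stone–Weierstrass gives uniform density, and duality with `C(A)` gives both uniqueness
statements. -/

namespace CompactFourier

open Filter Topology Set
open scoped InnerProductSpace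

set_option linter.overlappingInstances false

/-! ### Algebra of characters -/

section Characters

variable {A : Type*} [AddCommGroup A] [TopologicalSpace A]

@[simp] theorem charVal_zero (φ : DualGroup A) : charVal φ 0 = 1 := by
  simp [charVal]

theorem charVal_add (φ : DualGroup A) (x y : A) :
    charVal φ (x + y) = charVal φ x * charVal φ y := by
  simp [charVal, ofAdd_add]

@[simp] theorem norm_charVal (φ : DualGroup A) (x : A) : ‖charVal φ x‖ = 1 :=
  Circle.norm_coe _

theorem charVal_ne_zero (φ : DualGroup A) (x : A) : charVal φ x ≠ 0 := by
  simp [charVal]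

theorem charVal_neg (φ : DualGroup A) (x : A) : charVal φ (-x) = conj (charVal φ x) := by
  simp only [charVal, ofAdd_neg, map_inv]
  exact Circle.coe_inv_eq_conj _

theorem charVal_injective : Function.Injective (charVal (A := A)) := by
  intro φ ψ h
  ext x
  exact congrFun h x.toAdd

theorem exists_charVal_eq {m : A → ℂ} (hm : Continuous m) (hnorm : ∀ a, ‖m a‖ = 1)
    (hadd : ∀ a b, m (a + b) = m a * m b) : ∃ φ : DualGroup A, ∀ a, m a = charVal φ a := by
  let φ : Multiplicative A →ₜ* Circle :=
    { toFun := fun x => ⟨m x.toAdd, mem_sphere_zero_iff_norm.2 (hnorm _)⟩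
      map_one' := by
        have h := hadd 0 0
        have h0 : m 0 ≠ 0 := fun h => by simpa [h] using hnorm 0
        rw [add_zero] at h
        have : m 0 = 1 := by simpa [h0] using h
        exact Subtype.ext this
      map_mul' := fun x y => Subtype.ext (hadd _ _)
      continuous_toFun := (hm.comp continuous_toAdd).subtype_mk _ }
  exact ⟨φ, fun a => rfl⟩

end Characters

/-! ### Translations as commuting unitaries -/

section Translation

variable {A : Type*} [AddCommGroup A] [TopologicalSpace A] [IsTopologicalAddGroup A]
  [MeasurableSpace A] [BorelSpace A] (H : Measure A) [H.IsAddHaarMeasure]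

theorem coeFn_translation (a : A) (f : Lp ℂ 2 H) :
    translation H a f =ᵐ[H] fun x => f (x + a) :=
  Lp.coeFn_compMeasurePreserving f _

theorem translation_add_apply (a b : A) (f : Lp ℂ 2 H) :
    translation H (a + b) f = translation H a (translation H b f) := by
  refine Lp.ext ?_
  have h := (measurePreserving_add_right H a).quasiMeasurePreserving.ae (coeFn_translation H b f)
  filter_upwards [coeFn_translation H (a + b) f, coeFn_translation H a (translation H b f), h]
    with x h1 h2 h3
  rw [h1, h2, h3, add_assoc]

@[simp] theorem translation_zero_apply (f : Lp ℂ 2 H) : translation H 0 f = f := by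
  refine Lp.ext ?_
  filter_upwards [coeFn_translation H 0 f] with x h
  rw [h, add_zero]

@[simp] theorem translation_neg_translation (a : A) (f : Lp ℂ 2 H) :
    translation H (-a) (translation H a f) = f := by
  rw [← translation_add_apply, neg_add_cancel, translation_zero_apply]

@[simp] theorem translation_translation_neg (a : A) (f : Lp ℂ 2 H) :
    translation H a (translation H (-a) f) = f := by
  rw [← translation_add_apply, add_neg_cancel, translation_zero_apply]

theorem translation_comm_apply (a b : A) (f : Lp ℂ 2 H) :
    translation H a (translation H b f) = translation H b (translation H a f) := by
  rw [← translation_add_apply, add_comm, translation_add_apply]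

@[simp] theorem norm_translation_apply (a : A) (f : Lp ℂ 2 H) : ‖translation H a f‖ = ‖f‖ :=
  LinearIsometry.norm_map _ f

@[simp] theorem inner_translation_translation (a : A) (f g : Lp ℂ 2 H) :
    ⟪translation H a f, translation H a g⟫_ℂ = ⟪f, g⟫_ℂ :=
  LinearIsometry.inner_map_map _ f g

theorem inner_translation_left (a : A) (f g : Lp ℂ 2 H) :
    ⟪translation H a f, g⟫_ℂ = ⟪f, translation H (-a) g⟫_ℂ := by
  rw [← inner_translation_translation H (-a), translation_neg_translation]

theorem adjoint_translation (a : A) :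
    ContinuousLinearMap.adjoint (translation H a) = translation H (-a) := by
  refine ((ContinuousLinearMap.eq_adjoint_iff _ _).2 fun f g => ?_).symm
  rw [inner_translation_left, neg_neg]

theorem translation_mem_unitary (a : A) :
    translation H a ∈ unitary (Lp ℂ 2 H →L[ℂ] Lp ℂ 2 H) := by
  rw [Unitary.mem_iff, ContinuousLinearMap.star_eq_adjoint, adjoint_translation]
  constructor <;> ext1 f <;> simp

variable [CompactSpace A]

theorem continuous_translation_apply [R1Space A] [H.InnerRegularCompactLTTop] (f : Lp ℂ 2 H) :
    Continuous fun a => translation H a f := by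
  let g : C(A, C(A, A)) := (ContinuousMap.mk (fun p : A × A => p.2 + p.1)
    (continuous_snd.add continuous_fst)).curry
  exact Continuous.compMeasurePreservingLp (f := fun _ : A => f) (g := g) continuous_const
    g.continuous (fun a => measurePreserving_add_right H a) (by simp)

omit [IsTopologicalAddGroup A] in
theorem coeFn_charL2 (φ : DualGroup A) : charL2 H φ =ᵐ[H] charVal φ :=
  ContinuousMap.coeFn_toLp _ _

theorem translation_charL2 (a : A) (φ : DualGroup A) :
    translation H a (charL2 H φ) = charVal φ a • charL2 H φ := by
  refine Lp.ext ?_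
  have h := (measurePreserving_add_right H a).quasiMeasurePreserving.ae (coeFn_charL2 H φ)
  filter_upwards [coeFn_translation H a (charL2 H φ), coeFn_charL2 H φ,
    Lp.coeFn_smul (charVal φ a) (charL2 H φ), h] with x h1 h2 h3 h4
  rw [h1, h3, Pi.smul_apply, h2, h4, charVal_add, smul_eq_mul, mul_comm]

variable [IsProbabilityMeasure H]

/-- Translation by `a` multiplies `⟪φ, ψ⟫` by `conj (φ a) * ψ a` and preserves it, so a nonzero
inner product forces `φ = ψ`. -/
theorem orthonormal_charL2 : Orthonormal ℂ (charL2 (A := A) H) := by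
  constructor
  · intro φ
    have : ⟪charL2 H φ, charL2 H φ⟫_ℂ = 1 := by
      rw [L2.inner_def]
      have : ∀ᵐ x ∂H, ⟪charL2 H φ x, charL2 H φ x⟫_ℂ = 1 := by
        filter_upwards [coeFn_charL2 H φ] with x hx
        rw [hx, inner_self_eq_norm_sq_to_K]
        simp
      rw [integral_congr_ae this]
      simp
    rw [inner_self_eq_norm_sq_to_K] at this
    have h : ‖charL2 H φ‖ ^ 2 = 1 := Complex.ofReal_injective (by push_cast; exact this)
    exact (pow_eq_one_iff_of_nonneg (norm_nonneg _) two_ne_zero).1 h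
  · intro φ ψ hne
    by_contra h0
    refine hne (charVal_injective (funext fun a => ?_))
    have h := inner_translation_translation H a (charL2 H φ) (charL2 H ψ)
    rw [translation_charL2, translation_charL2, inner_smul_left, inner_smul_right,
      ← mul_assoc, mul_eq_right₀ h0] at h
    have h' : conj (charVal φ a) * charVal φ a = 1 := by
      rw [RCLike.conj_mul]; simp
    exact mul_left_cancel₀ ((map_ne_zero _).2 (charVal_ne_zero φ a)) (h'.trans h.symm)

theorem charL2_ne_zero (φ : DualGroup A) : charL2 H φ ≠ 0 :=
  (orthonormal_charL2 H).ne_zero φ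

end Translation

/-! ### Convolution as an average of translations -/

section ConvolutionOperator

variable {A : Type*} [AddCommGroup A] [TopologicalSpace A] [IsTopologicalAddGroup A]
  [CompactSpace A] [MeasurableSpace A] [BorelSpace A]
  (H : Measure A) [H.IsAddHaarMeasure] [H.Regular]

variable {H} in
theorem integrable_smul_translation {θ : A → ℂ} (hθ : Integrable θ H) (f : Lp ℂ 2 H) :
    Integrable (fun y => θ y • translation H (-y) f) H := by
  have hc : Continuous fun y => translation H (-y) f :=
    (continuous_translation_apply H f).comp continuous_neg
  refine (hθ.norm.mul_const ‖f‖).mono' (hθ.1.smul hc.aestronglyMeasurable_of_compactSpace) ?_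
  exact ae_of_all _ fun y => by rw [norm_smul, norm_translation_apply]

open Classical in
/-- Convolution by an integrable function `θ`, as the operator `∫ θ(y) T_{-y} dH(y)` on `L²(A)`. -/
noncomputable def convOp (θ : A → ℂ) : Lp ℂ 2 H →L[ℂ] Lp ℂ 2 H :=
  if hθ : Integrable θ H then
    LinearMap.mkContinuous
      { toFun := fun f => ∫ y, θ y • translation H (-y) f ∂H
        map_add' := fun f g => by
          simp only [map_add, smul_add]
          exact integral_add (integrable_smul_translation hθ f) (integrable_smul_translation hθ g)
        map_smul' := fun c f => by
          simp only [map_smul, RingHom.id_apply, smul_comm _ c, integral_smul] }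
      (∫ y, ‖θ y‖ ∂H) fun f => by
        refine (norm_integral_le_integral_norm _).trans_eq ?_
        simp only [norm_smul, norm_translation_apply, integral_mul_const]
  else 0

variable {H} {θ η : A → ℂ}

theorem convOp_apply (hθ : Integrable θ H) (f : Lp ℂ 2 H) :
    convOp H θ f = ∫ y, θ y • translation H (-y) f ∂H := by
  rw [convOp, dif_pos hθ]; rfl

theorem norm_convOp_le (hθ : Integrable θ H) : ‖convOp H θ‖ ≤ ∫ y, ‖θ y‖ ∂H := by
  rw [convOp, dif_pos hθ]
  exact LinearMap.mkContinuous_norm_le _ (integral_nonneg fun _ => norm_nonneg _) _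

theorem map_convOp_apply {E : Type*} [NormedAddCommGroup E] [NormedSpace ℂ E] [CompleteSpace E]
    (ℓ : Lp ℂ 2 H →L[ℂ] E) (hθ : Integrable θ H) (f : Lp ℂ 2 H) :
    ℓ (convOp H θ f) = ∫ y, θ y • ℓ (translation H (-y) f) ∂H := by
  rw [convOp_apply hθ, ← ℓ.integral_comp_comm (integrable_smul_translation hθ f)]
  simp only [map_smul]

theorem convOp_congr (h : θ =ᵐ[H] η) : convOp H θ = convOp H η := by
  by_cases hθ : Integrable θ H
  · have hη := hθ.congr h
    ext1 f
    rw [convOp_apply hθ, convOp_apply hη]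
    exact integral_congr_ae (h.mono fun y hy => by simp only [hy])
  · have hη : ¬Integrable η H := fun hη => hθ (hη.congr h.symm)
    rw [convOp, convOp, dif_neg hθ, dif_neg hη]

theorem convOp_add (hθ : Integrable θ H) (hη : Integrable η H) :
    convOp H (θ + η) = convOp H θ + convOp H η := by
  ext1 f
  rw [add_apply, convOp_apply hθ, convOp_apply hη, convOp_apply (hθ.add hη),
    ← integral_add (integrable_smul_translation hθ f) (integrable_smul_translation hη f)]
  simp only [Pi.add_apply, add_smul]

theorem convOp_sub (hθ : Integrable θ H) (hη : Integrable η H) :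
    convOp H (θ - η) = convOp H θ - convOp H η := by
  ext1 f
  rw [sub_apply, convOp_apply hθ, convOp_apply hη, convOp_apply (hθ.sub hη),
    ← integral_sub (integrable_smul_translation hθ f) (integrable_smul_translation hη f)]
  simp only [Pi.sub_apply, sub_smul]

theorem convOp_const_mul (c : ℂ) (hθ : Integrable θ H) :
    convOp H (fun x => c * θ x) = c • convOp H θ := by
  ext1 f
  rw [smul_apply, convOp_apply hθ, convOp_apply (hθ.const_mul c),
    ← integral_smul]
  simp only [mul_smul]

theorem translation_convOp_apply (hθ : Integrable θ H) (a : A) (f : Lp ℂ 2 H) :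
    translation H a (convOp H θ f) = convOp H θ (translation H a f) := by
  rw [map_convOp_apply _ hθ, convOp_apply hθ]
  simp only [translation_comm_apply H a]
  rfl

theorem commute_translation_convOp (hθ : Integrable θ H) (a : A) :
    Commute (translation H a) (convOp H θ) :=
  ContinuousLinearMap.ext fun f => translation_convOp_apply hθ a f

/-- No double integral is needed: `convOp H θ` passes under the integral defining `convOp H η` and
commutes with each translation there. -/
theorem commute_convOp (hθ : Integrable θ H) (hη : Integrable η H) :
    Commute (convOp H θ) (convOp H η) := by
  refine ContinuousLinearMap.ext fun f => ?_
  change convOp H θ (convOp H η f) = convOp H η (convOp H θ f)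
  rw [map_convOp_apply _ hη, convOp_apply hη]
  simp only [translation_convOp_apply hθ]
  rfl

omit [H.Regular] in
theorem integrable_conj_neg (hθ : Integrable θ H) : Integrable (fun x => conj (θ (-x))) H :=
  (LinearIsometryEquiv.integrable_comp_iff RCLike.conjLIE).2 hθ.comp_neg

/-- Since `T_{-y}` has adjoint `T_y`, the adjoint is `∫ conj (θ y) T_y dH(y)`; substitute `y ↦ -y`.
-/
theorem adjoint_convOp (hθ : Integrable θ H) :
    ContinuousLinearMap.adjoint (convOp H θ) = convOp H (fun x => conj (θ (-x))) := by
  refine ((ContinuousLinearMap.eq_adjoint_iff _ _).2 fun f g => ?_).symm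
  have h1 : ⟪f, convOp H θ g⟫_ℂ = ∫ y, θ y • ⟪f, translation H (-y) g⟫_ℂ ∂H :=
    map_convOp_apply (innerSL ℂ f) hθ g
  have h2 : ⟪g, convOp H (fun x => conj (θ (-x))) f⟫_ℂ =
      ∫ y, conj (θ (-y)) • ⟪g, translation H (-y) f⟫_ℂ ∂H :=
    map_convOp_apply (innerSL ℂ g) (integrable_conj_neg hθ) f
  rw [h1, ← inner_conj_symm, h2, ← integral_conj, ← integral_neg_eq_self]
  refine integral_congr_ae (ae_of_all _ fun y => ?_)
  simp only [neg_neg, smul_eq_mul, map_mul, RCLike.conj_conj, inner_conj_symm]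
  rw [inner_translation_left]

theorem isStarNormal_convOp (hθ : Integrable θ H) : IsStarNormal (convOp H θ) := by
  refine ⟨?_⟩
  rw [ContinuousLinearMap.star_eq_adjoint, adjoint_convOp hθ]
  exact commute_convOp (integrable_conj_neg hθ) hθ

theorem convOp_charL2 (hθ : Integrable θ H) (φ : DualGroup A) :
    convOp H θ (charL2 H φ) = fourierFun H θ φ • charL2 H φ := by
  rw [convOp_apply hθ, fourierFun, ← integral_smul_const]
  simp only [translation_charL2, charVal_neg, smul_smul]

end ConvolutionOperator

/-! ### Agreement with the pointwise convolution integral -/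

section ConvolutionFormula

variable {A : Type*} [AddCommGroup A] [TopologicalSpace A] [IsTopologicalAddGroup A]
  [CompactSpace A] [MeasurableSpace A] [BorelSpace A]
  {H : Measure A} [H.IsAddHaarMeasure] [H.Regular]

omit [H.IsAddHaarMeasure] in
/-- Subtraction on `A` need not be measurable for the product `σ`-algebra, but every integrable
function has a version whose composition with subtraction is. -/
theorem exists_ae_eq_measurable_comp_sub {f : A → ℂ} (hf : Integrable f H) :
    ∃ g : A → ℂ, f =ᵐ[H] g ∧ Measurable fun p : A × A => g (p.1 - p.2) := by
  have hε (n : ℕ) : ((n : ℝ≥0∞) + 1)⁻¹ ≠ 0 := by simp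
  choose g _ hg hgc hgm using fun n : ℕ =>
    (memLp_one_iff_integrable.2 hf).exists_hasCompactSupport_eLpNorm_sub_le ENNReal.one_ne_top
      (hε n)
  have hlim : Tendsto (fun n => eLpNorm (g n - f) 1 H) atTop (𝓝 0) := by
    have h0 : Tendsto (fun n : ℕ => ((n : ℝ≥0∞) + 1)⁻¹) atTop (𝓝 0) := by
      have := (tendsto_add_atTop_iff_nat 1).2 ENNReal.tendsto_inv_nat_nhds_zero
      simpa using this
    refine tendsto_of_tendsto_of_tendsto_of_le_of_le tendsto_const_nhds h0 (fun _ => zero_le)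
      fun n => ?_
    rw [eLpNorm_sub_comm]
    exact hg n
  obtain ⟨ns, -, hns⟩ := (tendstoInMeasure_of_tendsto_eLpNorm one_ne_zero
    (fun n => (hgm n).1) hf.1 hlim).exists_seq_tendsto_ae
  -- The `g (ns n)` are continuous and converge to `f` almost everywhere. `limUnder` takes an
  -- arbitrary value where there is no limit, yet remains measurable everywhere.
  refine ⟨fun x => limUnder atTop fun n => g (ns n) x, hns.mono fun x hx => hx.limUnder_eq.symm, ?_⟩
  refine (StronglyMeasurable.limUnder (l := atTop)
    (f := fun n (p : A × A) => g (ns n) (p.1 - p.2)) fun n => ?_).measurable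
  exact (HasCompactSupport.measurable_of_prod
    ((hgc (ns n)).comp (continuous_fst.sub continuous_snd))
    (HasCompactSupport.of_compactSpace _)).stronglyMeasurable

omit [H.Regular] in
theorem ae_eq_comp_sub_left {f g : A → ℂ} (h : f =ᵐ[H] g) (x : A) :
    (fun y => f (x - y)) =ᵐ[H] fun y => g (x - y) :=
  (Measure.measurePreserving_sub_left H x).quasiMeasurePreserving.ae h

omit [H.Regular] in
theorem integrable_prod_mul_sub {θ g : A → ℂ} (hθ : Integrable θ H) (hg : Integrable g H)
    (hgm : Measurable fun p : A × A => g (p.1 - p.2)) :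
    Integrable (fun p : A × A => θ p.2 * g (p.1 - p.2)) (H.prod H) := by
  refine (integrable_prod_iff' (hθ.1.comp_snd.mul hgm.aestronglyMeasurable)).2 ⟨?_, ?_⟩
  · exact ae_of_all _ fun y => (hg.comp_sub_right y).const_mul (θ y)
  · have h (y : A) : ∫ x, ‖θ y * g (x - y)‖ ∂H = ‖θ y‖ * ∫ x, ‖g x‖ ∂H := by
      simp only [norm_mul, integral_const_mul]
      rw [integral_sub_right_eq_self fun x => ‖g x‖]
    exact (hθ.norm.mul_const _).congr (ae_of_all _ fun y => (h y).symm)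

theorem ae_convolutionExistsAt {θ f : A → ℂ} (hθ : Integrable θ H) (hf : Integrable f H) :
    ∀ᵐ x ∂H, ConvolutionExistsAt θ f x (ContinuousLinearMap.mul ℂ ℂ) H := by
  obtain ⟨g, hfg, hgm⟩ := exists_ae_eq_measurable_comp_sub hf
  filter_upwards [(integrable_prod_mul_sub hθ (hf.congr hfg) hgm).prod_right_ae] with x hx
  refine hx.congr ?_
  filter_upwards [ae_eq_comp_sub_left hfg x] with y hy
  rw [ContinuousLinearMap.mul_apply', hy]

/-- Both sides have the same integral over every measurable set: pairing with an indicator commutes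
with the Bochner integral on one side, and Fubini applies on the other. -/
theorem convOp_ae_eq_conv {θ : A → ℂ} (hθ : Integrable θ H) (f : Lp ℂ 2 H) :
    convOp H θ f =ᵐ[H] conv H θ f := by
  have hf : Integrable f H := (Lp.memLp f).integrable one_le_two
  obtain ⟨g, hfg, hgm⟩ := exists_ae_eq_measurable_comp_sub hf
  have hF := integrable_prod_mul_sub hθ (hf.congr hfg) hgm
  -- For each fixed `x` the version `g` changes the integrand only on a null set, so this equality
  -- holds everywhere.
  have hconv : conv H θ f = fun x => ∫ y, θ y * g (x - y) ∂H := by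
    funext x
    refine integral_congr_ae ?_
    filter_upwards [ae_eq_comp_sub_left hfg x] with y hy
    rw [ContinuousLinearMap.mul_apply', hy]
  rw [hconv]
  refine Integrable.ae_eq_of_forall_setIntegral_eq _ _
    ((Lp.memLp _).integrable one_le_two) hF.integral_prod_left fun s hs hsH => ?_
  have hFs : Integrable (fun p : A × A => θ p.2 * g (p.1 - p.2)) ((H.restrict s).prod H) := by
    have := hF.restrict (s := s ×ˢ univ)
    rwa [← Measure.prod_restrict, Measure.restrict_univ] at this
  rw [integral_integral_swap hFs, ← L2.inner_indicatorConstLp_one (𝕜 := ℂ) hs hsH.ne]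
  refine (map_convOp_apply (innerSL ℂ _) hθ f).trans (integral_congr_ae (ae_of_all _ fun y => ?_))
  beta_reduce
  rw [innerSL_apply_apply, L2.inner_indicatorConstLp_one, smul_eq_mul, ← integral_const_mul]
  refine integral_congr_ae (ae_restrict_of_ae ?_)
  filter_upwards [coeFn_translation H (-y) f,
    (measurePreserving_add_right H (-y)).quasiMeasurePreserving.ae hfg] with x hx hx'
  rw [hx, hx', sub_eq_add_neg]

theorem convOp_comm (f g : Lp ℂ 2 H) : convOp H f g = convOp H g f := by
  refine Lp.ext ?_
  filter_upwards [convOp_ae_eq_conv ((Lp.memLp f).integrable one_le_two) g,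
    convOp_ae_eq_conv ((Lp.memLp g).integrable one_le_two) f] with x h1 h2
  rw [h1, h2, conv, conv, ← convolution_flip]
  congr 1
  ext; simp

end ConvolutionFormula

/-! ### Finite rank approximation and compactness -/

theorem isCompactOperator_of_finiteDimensional_range {E F : Type*} [NormedAddCommGroup E]
    [NormedSpace ℂ E] [NormedAddCommGroup F] [NormedSpace ℂ F] (T : E →L[ℂ] F)
    (hT : FiniteDimensional ℂ (LinearMap.range (T : E →ₗ[ℂ] F))) : IsCompactOperator T :=
  ((isCompactOperator_id_iff_finiteDimensional.2 hT).comp_clm T.rangeRestrict).clm_comp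
    (LinearMap.range (T : E →ₗ[ℂ] F)).subtypeL

theorem exists_simpleFunc_dist_lt {X E : Type*} [TopologicalSpace X] [CompactSpace X]
    [MeasurableSpace X] [BorelSpace X] [PseudoMetricSpace E] [Zero E] {f : X → E}
    (hf : Continuous f) {ε : ℝ} (hε : 0 < ε) : ∃ g : SimpleFunc X E, ∀ x, dist (f x) (g x) < ε := by
  -- The one-point second factor puts `f` into the form of a compactly supported function on a
  -- product.
  obtain ⟨g, hg⟩ := (HasCompactSupport.of_compactSpace fun p : X × Unit => f p.1)
    |>.exists_simpleFunc_approx_of_prod (hf.comp continuous_fst) hε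
  exact ⟨g.comp (fun x => (x, ())) measurable_prodMk_right, fun x => hg (x, ())⟩

theorem integral_norm_le_norm {X : Type*} [MeasurableSpace X] {H : Measure X}
    [IsProbabilityMeasure H] (f : Lp ℂ 2 H) :
    ∫ x, ‖f x‖ ∂H ≤ ‖f‖ := by
  have hf := Lp.memLp f
  rw [Lp.norm_def, integral_norm_eq_lintegral_enorm hf.1, ← eLpNorm_one_eq_lintegral_enorm]
  exact ENNReal.toReal_mono hf.2.ne (eLpNorm_le_eLpNorm_of_exponent_le one_le_two hf.1)

section Compact

variable {A : Type*} [AddCommGroup A] [TopologicalSpace A] [IsTopologicalAddGroup A]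
  [CompactSpace A] [MeasurableSpace A] [BorelSpace A]
  {H : Measure A}

variable [H.IsAddHaarMeasure] [H.Regular] [IsProbabilityMeasure H] {θ : A → ℂ}

/-- The closure of the finite rank operators in the operator norm. -/
abbrev finiteRankClosure (H : Measure A) : Set (Lp ℂ 2 H →L[ℂ] Lp ℂ 2 H) :=
  closure {F : Lp ℂ 2 H →L[ℂ] Lp ℂ 2 H |
    FiniteDimensional ℂ (LinearMap.range (F : Lp ℂ 2 H →ₗ[ℂ] Lp ℂ 2 H))}

/-- The orbit map `y ↦ T_{-y}u` is replaced by a uniformly close simple function `g`; the operator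
`f ↦ ∫ f(y) g(y) dH(y)` has range in the span of the finitely many values of `g`. -/
theorem convOp_mem_finiteRankClosure_of_Lp (u : Lp ℂ 2 H) :
    convOp H u ∈ finiteRankClosure H := by
  refine Metric.mem_closure_iff.2 fun ε hε => ?_
  have hc : Continuous fun y => translation H (-y) u :=
    (continuous_translation_apply H u).comp continuous_neg
  obtain ⟨g, hg⟩ := exists_simpleFunc_dist_lt hc (half_pos hε)
  have hint (f : Lp ℂ 2 H) : Integrable f H := (Lp.memLp f).integrable one_le_two
  have hgb (y : A) : ‖g y‖ ≤ ‖u‖ + ε / 2 := by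
    have h1 := hg y
    rw [dist_eq_norm, norm_sub_rev] at h1
    have h2 := norm_le_norm_add_norm_sub' (g y) (translation H (-y) u)
    rw [norm_translation_apply] at h2
    linarith
  have hgi (f : Lp ℂ 2 H) : Integrable (fun y => f y • g y) H := by
    refine ((hint f).norm.mul_const (‖u‖ + ε / 2)).mono'
      ((hint f).1.smul g.stronglyMeasurable.aestronglyMeasurable) (ae_of_all _ fun y => ?_)
    rw [norm_smul]
    exact mul_le_mul_of_nonneg_left (hgb y) (norm_nonneg _)
  let F : Lp ℂ 2 H →L[ℂ] Lp ℂ 2 H := LinearMap.mkContinuous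
    { toFun := fun f => ∫ y, f y • g y ∂H
      map_add' := fun f f' => by
        rw [← integral_add (hgi f) (hgi f')]
        refine integral_congr_ae ?_
        filter_upwards [Lp.coeFn_add f f'] with y hy
        rw [hy, Pi.add_apply, add_smul]
      map_smul' := fun c f => by
        rw [RingHom.id_apply, ← integral_smul]
        refine integral_congr_ae ?_
        filter_upwards [Lp.coeFn_smul c f] with y hy
        rw [hy, Pi.smul_apply, smul_assoc] }
    (‖u‖ + ε / 2) fun f => by
      refine (norm_integral_le_of_norm_le ((hint f).norm.mul_const (‖u‖ + ε / 2))
        (ae_of_all _ fun y => ?_)).trans ?_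
      · rw [norm_smul]
        exact mul_le_mul_of_nonneg_left (hgb y) (norm_nonneg _)
      · rw [integral_mul_const, mul_comm]
        exact mul_le_mul_of_nonneg_left (integral_norm_le_norm f) (by positivity)
  refine ⟨F, ?_, ?_⟩
  · let S : Submodule ℂ (Lp ℂ 2 H) := Submodule.span ℂ (Set.range g)
    have hS : FiniteDimensional ℂ S := FiniteDimensional.span_of_finite ℂ g.finite_range
    refine Submodule.finiteDimensional_of_le (S₂ := S) ?_
    rintro _ ⟨f, rfl⟩
    -- Integrating inside the finite-dimensional `S` shows that the integral does not leave `S`.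
    have h : F f = S.subtypeₗᵢ (∫ y, f y • (⟨g y, Submodule.subset_span ⟨y, rfl⟩⟩ : S) ∂H) := by
      rw [← LinearIsometry.integral_comp_comm]
      rfl
    change F f ∈ S
    rw [h]
    exact Subtype.property _
  · refine lt_of_le_of_lt ?_ (half_lt_self hε)
    rw [dist_eq_norm]
    refine ContinuousLinearMap.opNorm_le_bound _ (half_pos hε).le fun f => ?_
    -- Commutativity of convolution moves the translations from `f` to the fixed function `u`.
    have h : (convOp H u - F) f = ∫ y, f y • (translation H (-y) u - g y) ∂H := by
      simp only [smul_sub]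
      rw [integral_sub (integrable_smul_translation (hint f) u) (hgi f), sub_apply, convOp_comm,
        convOp_apply (hint f)]
      rfl
    rw [h]
    refine (norm_integral_le_of_norm_le ((hint f).norm.mul_const (ε / 2))
      (ae_of_all _ fun y => ?_)).trans ?_
    · rw [norm_smul, ← dist_eq_norm]
      exact mul_le_mul_of_nonneg_left (hg y).le (norm_nonneg _)
    · rw [integral_mul_const, mul_comm]
      exact mul_le_mul_of_nonneg_left (integral_norm_le_norm f) (by positivity)

/-- Continuous functions lie in `L²` and are dense in `L¹`, and `θ ↦ convOp H θ` is contractive from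
the `L¹` norm to the operator norm. -/
theorem convOp_mem_finiteRankClosure (hθ : Integrable θ H) :
    convOp H θ ∈ finiteRankClosure H := by
  refine isClosed_closure.closure_subset (Metric.mem_closure_iff.2 fun ε hε => ?_)
  obtain ⟨g, -, hg, hgc, hgi⟩ := hθ.exists_hasCompactSupport_integral_sub_le (half_pos hε)
  have hg2 : MemLp g 2 H := hgc.memLp_of_hasCompactSupport (HasCompactSupport.of_compactSpace g)
  refine ⟨convOp H (hg2.toLp g), convOp_mem_finiteRankClosure_of_Lp _, ?_⟩
  rw [convOp_congr hg2.coeFn_toLp, dist_eq_norm, ← convOp_sub hθ hgi]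
  exact ((norm_convOp_le (hθ.sub hgi)).trans hg).trans_lt (half_lt_self hε)

theorem isCompactOperator_convOp (hθ : Integrable θ H) : IsCompactOperator (convOp H θ) :=
  closure_minimal (fun F hF => isCompactOperator_of_finiteDimensional_range F hF)
    isClosed_setOfPred_isCompactOperator (convOp_mem_finiteRankClosure hθ)

end Compact

/-! ### Invariant subspaces and completeness of the characters -/

section Spectral

variable {A : Type*} [AddCommGroup A] [TopologicalSpace A] [IsTopologicalAddGroup A]
  [CompactSpace A] [MeasurableSpace A] [BorelSpace A]
  {H : Measure A} [H.IsAddHaarMeasure] [H.Regular] [IsProbabilityMeasure H] {θ : A → ℂ}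

theorem convOp_charL2_eq_self {f : Lp ℂ 2 H} {φ : DualGroup A}
    (h : ∀ a, translation H a f = charVal φ a • f) :
    convOp H (charL2 H φ) f = f := by
  rw [convOp_apply ((Lp.memLp _).integrable one_le_two)]
  have : ∀ᵐ y ∂H, charL2 H φ y • translation H (-y) f = f := by
    filter_upwards [coeFn_charL2 H φ] with y hy
    rw [hy, h, smul_smul, ← charVal_add, add_neg_cancel, charVal_zero, one_smul]
  rw [integral_congr_ae this]
  simp

/-- Continuity of `m` comes from `m a = ⟪f, T_a f⟫ / ⟪f, f⟫`. Once `m` is a character `φ`, computing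
`φ * f` in both orders gives `f = φ * f = f * φ`, a multiple of `φ`. -/
theorem exists_charVal_of_translation_eq_smul {f : Lp ℂ 2 H} {m : A → ℂ} (hf : f ≠ 0)
    (h : ∀ a, translation H a f = m a • f) :
    ∃ φ : DualGroup A, (∀ a, m a = charVal φ a) ∧ ∃ c : ℂ, f = c • charL2 H φ := by
  have hff : ⟪f, f⟫_ℂ ≠ 0 := inner_self_ne_zero.2 hf
  have hm : Continuous m := by
    have : m = fun a => ⟪f, translation H a f⟫_ℂ / ⟪f, f⟫_ℂ := by
      funext a
      rw [h, inner_smul_right, mul_div_cancel_right₀ _ hff]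
    rw [this]
    exact (continuous_const.inner (continuous_translation_apply H f)).div_const _
  have hnorm (a : A) : ‖m a‖ = 1 := by
    have := norm_translation_apply H a f
    rwa [h, norm_smul, mul_eq_right₀ (norm_ne_zero_iff.2 hf)] at this
  have hadd (a b : A) : m (a + b) = m a * m b := by
    have := translation_add_apply H a b f
    rw [h, h b, map_smul, h a, smul_smul, mul_comm] at this
    exact smul_left_injective ℂ hf this
  obtain ⟨φ, hφ⟩ := exists_charVal_eq hm hnorm hadd
  refine ⟨φ, hφ, fourierFun H f φ, ?_⟩
  rw [← convOp_charL2 ((Lp.memLp _).integrable one_le_two), ← convOp_comm,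
    convOp_charL2_eq_self fun a => by rw [h, hφ]]

/-- Induction on dimension. If all translations are scalar on `V`, any nonzero vector is a multiple
of a character. Otherwise some `T_a` has an eigenspace in `V` that is nonzero, proper and, by
commutativity, invariant. -/
theorem exists_charL2_mem (V : Submodule ℂ (Lp ℂ 2 H)) [FiniteDimensional ℂ V] (hV : V ≠ ⊥)
    (hT : ∀ a, ∀ f ∈ V, translation H a f ∈ V) : ∃ φ : DualGroup A, charL2 H φ ∈ V := by
  induction hn : Module.finrank ℂ V using Nat.strong_induction_on generalizing V with
  | _ n ih =>
    subst hn
    by_cases hs : ∀ a, ∃ c : ℂ, ∀ f ∈ V, translation H a f = c • f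
    · choose m hm using hs
      obtain ⟨f, hfV, hf⟩ := Submodule.exists_mem_ne_zero_of_ne_bot hV
      obtain ⟨φ, -, c, hc⟩ := exists_charVal_of_translation_eq_smul hf fun a => hm a f hfV
      have hc0 : c ≠ 0 := fun h => hf (by rw [hc, h, zero_smul])
      exact ⟨φ, (V.smul_mem_iff hc0).1 (hc ▸ hfV)⟩
    · push Not at hs
      obtain ⟨a, ha⟩ := hs
      have : Nontrivial V := Submodule.nontrivial_iff_ne_bot.2 hV
      obtain ⟨μ, hμ⟩ := Module.End.exists_eigenvalue
        ((translation H a : Lp ℂ 2 H →ₗ[ℂ] Lp ℂ 2 H).restrict (hT a))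
      obtain ⟨v, hv⟩ := hμ.exists_hasEigenvector
      let W : Submodule ℂ (Lp ℂ 2 H) :=
        V ⊓ Module.End.eigenspace (translation H a : Lp ℂ 2 H →ₗ[ℂ] Lp ℂ 2 H) μ
      have hWV : W < V := by
        refine lt_of_le_of_ne inf_le_left fun h => ?_
        obtain ⟨f, hfV, hf⟩ := ha μ
        exact hf (Module.End.mem_eigenspace_iff.1 ((inf_eq_left.1 h) hfV))
      have : FiniteDimensional ℂ W := Submodule.finiteDimensional_of_le hWV.le
      have hW : W ≠ ⊥ := by
        refine (Submodule.ne_bot_iff _).2 ⟨v, ⟨v.2, ?_⟩, fun h => hv.2 (Subtype.ext h)⟩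
        exact Module.End.mem_eigenspace_iff.2 (congrArg Subtype.val hv.apply_eq_smul)
      obtain ⟨φ, hφ⟩ := ih _ (Submodule.finrank_lt_finrank_of_lt hWV) W hW (fun b f hf => by
        refine ⟨hT b f hf.1, Module.End.mem_eigenspace_iff.2 ?_⟩
        have h := Module.End.mem_eigenspace_iff.1 hf.2
        change translation H a f = μ • f at h
        change translation H a (translation H b f) = _
        rw [translation_comm_apply, h, map_smul]) rfl
      exact ⟨φ, hWV.le hφ⟩

/-- By unitarity the complement in `V` of the span of its characters is invariant; if nonzero it
would contain a character, which would be orthogonal to itself. -/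
theorem span_charL2_eq (V : Submodule ℂ (Lp ℂ 2 H)) [FiniteDimensional ℂ V]
    (hT : ∀ a, ∀ f ∈ V, translation H a f ∈ V) :
    Submodule.span ℂ (charL2 H '' {φ : DualGroup A | charL2 H φ ∈ V}) = V := by
  set W := Submodule.span ℂ (charL2 H '' {φ : DualGroup A | charL2 H φ ∈ V}) with hW
  have hWV : W ≤ V := Submodule.span_le.2 (image_subset_iff.2 fun φ hφ => hφ)
  have : FiniteDimensional ℂ W := Submodule.finiteDimensional_of_le hWV
  have : FiniteDimensional ℂ (Wᗮ ⊓ V : Submodule ℂ (Lp ℂ 2 H)) :=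
    Submodule.finiteDimensional_of_le inf_le_right
  have hperp : Wᗮ ⊓ V = ⊥ := by
    by_contra hne
    obtain ⟨φ, hφ⟩ := exists_charL2_mem (Wᗮ ⊓ V) hne fun a f hf => by
      refine ⟨?_, hT a f hf.2⟩
      refine (Submodule.mem_orthogonal _ _).2 fun g hg => ?_
      induction hg using Submodule.span_induction with
      | mem g hg =>
        obtain ⟨φ, hφ, rfl⟩ := hg
        rw [← neg_neg a, ← inner_translation_left, translation_charL2, inner_smul_left,
          (Submodule.mem_orthogonal _ _).1 hf.1 _ (Submodule.subset_span ⟨φ, hφ, rfl⟩),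
          mul_zero]
      | zero => exact inner_zero_left _
      | add g g' _ _ h h' => rw [inner_add_left, h, h', add_zero]
      | smul c g _ h => rw [inner_smul_left, h, mul_zero]
    exact charL2_ne_zero H φ (inner_self_eq_zero.1
      ((Submodule.mem_orthogonal _ _).1 hφ.1 _ (Submodule.subset_span ⟨φ, hφ.2, rfl⟩)))
  have := Submodule.sup_orthogonal_inf_of_hasOrthogonalProjection hWV
  rwa [hperp, sup_bot_eq] at this

theorem exists_orthonormalBasis_charL2 (V : Submodule ℂ (Lp ℂ 2 H)) [FiniteDimensional ℂ V]
    (hT : ∀ a, ∀ f ∈ V, translation H a f ∈ V) :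
    ∃ (s : Finset (DualGroup A)) (b : OrthonormalBasis s ℂ V),
      ∀ φ : s, (b φ : Lp ℂ 2 H) = charL2 H (φ : DualGroup A) := by
  let S : Set (DualGroup A) := {φ | charL2 H φ ∈ V}
  let v : S → V := fun φ => ⟨charL2 H φ, φ.2⟩
  have hv : Orthonormal ℂ v := by
    have h := (orthonormal_charL2 (A := A) H).comp (Subtype.val : S → DualGroup A)
      Subtype.val_injective
    exact ⟨fun φ => h.1 φ, fun φ ψ hne => h.2 hne⟩
  have hS : S.Finite := hv.linearIndependent.finite_of_isNoetherian
  let w : hS.toFinset → V := fun φ => v ⟨φ, hS.mem_toFinset.1 φ.2⟩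
  have hw : Orthonormal ℂ w := hv.comp (fun φ : hS.toFinset => (⟨φ, hS.mem_toFinset.1 φ.2⟩ : S))
    fun φ ψ h => Subtype.ext (congrArg (fun x : S => (x : DualGroup A)) h)
  refine ⟨hS.toFinset, OrthonormalBasis.mk hw ?_, fun φ => ?_⟩
  · rintro ⟨f, hf⟩ -
    have hspan : (Submodule.span ℂ (Set.range w)).map V.subtype = V := by
      rw [Submodule.map_span, ← Set.range_comp]
      convert span_charL2_eq V hT using 2
      ext g
      constructor
      · rintro ⟨φ, rfl⟩
        exact ⟨φ, hS.mem_toFinset.1 φ.2, rfl⟩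
      · rintro ⟨φ, hφ, rfl⟩
        exact ⟨⟨φ, hS.mem_toFinset.2 hφ⟩, rfl⟩
    rw [← hspan] at hf
    obtain ⟨g, hg, hgf⟩ := hf
    rwa [← show g = ⟨f, _⟩ from Subtype.ext hgf]
  · rw [OrthonormalBasis.coe_mk]

omit [IsProbabilityMeasure H] in
theorem translation_mem_eigenspace (hθ : Integrable θ H) (l : ℂ) (a : A) {f : Lp ℂ 2 H}
    (hf : f ∈ Module.End.eigenspace (convOp H θ : Lp ℂ 2 H →ₗ[ℂ] Lp ℂ 2 H) l) :
    translation H a f ∈ Module.End.eigenspace (convOp H θ : Lp ℂ 2 H →ₗ[ℂ] Lp ℂ 2 H) l := by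
  have h := Module.End.mem_eigenspace_iff.1 hf
  refine Module.End.mem_eigenspace_iff.2 ?_
  change convOp H θ f = l • f at h
  change convOp H θ (translation H a f) = _
  rw [← translation_convOp_apply hθ, h, map_smul]

omit [IsProbabilityMeasure H] in
theorem map_translation_eigenspace (hθ : Integrable θ H) (a : A) (l : ℂ) :
    (Module.End.eigenspace (convOp H θ : Lp ℂ 2 H →ₗ[ℂ] Lp ℂ 2 H) l).map
        (translation H a : Lp ℂ 2 H →ₗ[ℂ] Lp ℂ 2 H) =
      Module.End.eigenspace (convOp H θ : Lp ℂ 2 H →ₗ[ℂ] Lp ℂ 2 H) l := by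
  refine le_antisymm ?_ fun f hf => ?_
  · rintro _ ⟨f, hf, rfl⟩
    exact translation_mem_eigenspace hθ l a hf
  · exact ⟨translation H (-a) f, translation_mem_eigenspace hθ l (-a) hf,
      translation_translation_neg H a f⟩

theorem finiteDimensional_eigenspace_convOp (hθ : Integrable θ H) {l : ℂ} (hl : l ≠ 0) :
    FiniteDimensional ℂ (Module.End.eigenspace (convOp H θ : Lp ℂ 2 H →ₗ[ℂ] Lp ℂ 2 H) l) :=
  ContinuousLinearMap.finite_dimensional_eigenspace (isCompactOperator_convOp hθ) l hl

/-- The symmetry of `θ` makes the operator self-adjoint and compact, so it suffices that `convOp H θ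
f` is orthogonal to every eigenspace. For eigenvalue `0` this is self-adjointness; the other
eigenspaces are spanned by characters. -/
theorem convOp_eq_zero_of_orthogonal_of_symm (hθ : Integrable θ H)
    (hsymm : (fun x => conj (θ (-x))) = θ) {f : Lp ℂ 2 H}
    (hf : ∀ φ : DualGroup A, ⟪charL2 H φ, f⟫_ℂ = 0) : convOp H θ f = 0 := by
  have hadj : ContinuousLinearMap.adjoint (convOp H θ) = convOp H θ := by
    rw [adjoint_convOp hθ, hsymm]
  have hbot := ContinuousLinearMap.orthogonalComplement_iSup_eigenspaces_eq_bot
    (isCompactOperator_convOp hθ)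
    (ContinuousLinearMap.isSelfAdjoint_iff_isSymmetric.1 hadj)
  rw [← Submodule.mem_bot ℂ, ← hbot, ← Submodule.iInf_orthogonal, Submodule.mem_iInf]
  intro l
  refine (Submodule.mem_orthogonal _ _).2 fun g hg => ?_
  have hgl : convOp H θ g = l • g := Module.End.mem_eigenspace_iff.1 hg
  rw [← ContinuousLinearMap.adjoint_inner_left, hadj, hgl, inner_smul_left]
  by_cases hl : l = 0
  · rw [hl, map_zero, zero_mul]
  have := finiteDimensional_eigenspace_convOp hθ hl
  rw [← span_charL2_eq _ fun a f hf => translation_mem_eigenspace hθ l a hf] at hg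
  have : ⟪g, f⟫_ℂ = 0 := by
    refine Submodule.inner_right_of_mem_orthogonal hg ((Submodule.mem_orthogonal' _ _).2 ?_)
    intro k hk
    induction hk using Submodule.span_induction with
    | mem k hk =>
      obtain ⟨φ, -, rfl⟩ := hk
      exact inner_eq_zero_symm.1 (hf φ)
    | zero => exact inner_zero_right _
    | add g g' _ _ h h' => rw [inner_add_right, h, h', add_zero]
    | smul c g _ h => rw [inner_smul_right, h, mul_zero]
  rw [this, mul_zero]

/-- Both `θ + η` and `I * (θ - η)` are fixed by `θ ↦ conj (θ (-x))`, which reduces to the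
self-adjoint case. -/
theorem convOp_eq_zero_of_orthogonal (hθ : Integrable θ H) {f : Lp ℂ 2 H}
    (hf : ∀ φ : DualGroup A, ⟪charL2 H φ, f⟫_ℂ = 0) : convOp H θ f = 0 := by
  have hθ' := integrable_conj_neg hθ
  set η : A → ℂ := fun x => conj (θ (-x)) with hη
  have h1 : convOp H (θ + η) f = 0 := by
    refine convOp_eq_zero_of_orthogonal_of_symm (hθ.add hθ') ?_ hf
    funext x
    simp [hη, add_comm]
  have h2 : convOp H (fun x => Complex.I * (θ - η) x) f = 0 := by
    refine convOp_eq_zero_of_orthogonal_of_symm ((hθ.sub hθ').const_mul _) ?_ hf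
    funext x
    simp [hη]
    ring
  rw [convOp_add hθ hθ', add_apply] at h1
  rw [convOp_const_mul _ (hθ.sub hθ'), convOp_sub hθ hθ', smul_apply,
    smul_eq_zero_iff_right Complex.I_ne_zero, sub_apply, sub_eq_zero] at h2
  rw [← h2, ← two_smul ℂ, smul_eq_zero_iff_right two_ne_zero] at h1
  exact h1

omit [IsProbabilityMeasure H] in
-- In place of an approximate identity, test with the conjugate of `h y = ⟪f, T_{-y} f⟫`: then `∫
-- |h|² = 0`, and by continuity `h 0 = ⟪f, f⟫` vanishes.
theorem eq_zero_of_convOp_eq_zero {f : Lp ℂ 2 H}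
    (hf : ∀ θ : A → ℂ, Integrable θ H → convOp H θ f = 0) : f = 0 := by
  let h : A → ℂ := fun y => ⟪f, translation H (-y) f⟫_ℂ
  have hc : Continuous h :=
    continuous_const.inner ((continuous_translation_apply H f).comp continuous_neg)
  have hθ : Integrable (fun y => conj (h y)) H :=
    (Complex.continuous_conj.comp hc).integrable_of_hasCompactSupport
      (HasCompactSupport.of_compactSpace _)
  have h0 : ∫ y, conj (h y) • h y ∂H = 0 := by
    refine (map_convOp_apply (innerSL ℂ f) hθ f).symm.trans ?_
    rw [hf _ hθ, map_zero]
  have h1 : ∫ y, ‖h y‖ ^ 2 ∂H = 0 := by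
    have : ((∫ y, ‖h y‖ ^ 2 ∂H : ℝ) : ℂ) = 0 := by
      rw [← integral_complex_ofReal, ← h0]
      refine integral_congr_ae (ae_of_all _ fun y => ?_)
      simp only [smul_eq_mul, RCLike.conj_mul]
      push_cast
      rfl
    exact Complex.ofReal_eq_zero.1 this
  have hsq : Continuous fun y => ‖h y‖ ^ 2 := hc.norm.pow 2
  rw [integral_eq_zero_iff_of_nonneg (fun y => by positivity)
    (hsq.integrable_of_hasCompactSupport (HasCompactSupport.of_compactSpace _)),
    Continuous.ae_eq_iff_eq H hsq continuous_zero] at h1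
  have h2 : ⟪f, f⟫_ℂ = 0 := by
    have := congrFun h1 0
    simpa [h] using this
  exact inner_self_eq_zero.1 h2

theorem orthogonal_span_charL2 :
    (Submodule.span ℂ (Set.range (charL2 (A := A) H)))ᗮ = ⊥ := by
  refine (Submodule.eq_bot_iff _).2 fun f hf => eq_zero_of_convOp_eq_zero fun θ hθ =>
    convOp_eq_zero_of_orthogonal hθ fun φ =>
      (Submodule.mem_orthogonal _ _).1 hf _ (Submodule.subset_span ⟨φ, rfl⟩)

theorem dense_span_charL2 :
    Dense (Submodule.span ℂ (Set.range (charL2 (A := A) H)) : Set (Lp ℂ 2 H)) :=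
  Submodule.dense_iff_topologicalClosure_eq_top.2
    (Submodule.topologicalClosure_eq_top_iff.2 orthogonal_span_charL2)

theorem exists_hilbertBasis_charL2 :
    ∃ b : HilbertBasis (DualGroup A) ℂ (Lp ℂ 2 H), ∀ φ, b φ = charL2 H φ :=
  ⟨HilbertBasis.mkOfOrthogonalEqBot (orthonormal_charL2 H) orthogonal_span_charL2, fun φ => by
    rw [HilbertBasis.coe_mkOfOrthogonalEqBot]⟩

theorem exists_hilbertBasis_eigenvectors (hθ : Integrable θ H) :
    ∃ (s : Set (Lp ℂ 2 H)) (b : HilbertBasis s ℂ (Lp ℂ 2 H)),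
      ∀ v : s, b v = v ∧ ∃ l : ℂ, convOp H θ (v : Lp ℂ 2 H) = l • (v : Lp ℂ 2 H) := by
  refine ⟨Set.range (charL2 (A := A) H), HilbertBasis.mkOfOrthogonalEqBot
    (orthonormal_charL2 H).toSubtypeRange ?_, fun v => ⟨?_, ?_⟩⟩
  · rw [Subtype.range_coe]
    exact orthogonal_span_charL2
  · rw [HilbertBasis.coe_mkOfOrthogonalEqBot]
  · obtain ⟨_, φ, rfl⟩ := v
    exact ⟨_, convOp_charL2 hθ φ⟩

end Spectral

/-! ### Separation of points and uniform density -/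

section Uniform

variable {A : Type*} [AddCommGroup A] [TopologicalSpace A]

theorem charC_one : charC (1 : DualGroup A) = 1 := by
  ext x
  exact Circle.coe_one

theorem charC_mul (φ ψ : DualGroup A) : charC (φ * ψ) = charC φ * charC ψ := by
  ext x
  exact Circle.coe_mul _ _

theorem charVal_inv (φ : DualGroup A) (x : A) : charVal φ⁻¹ x = conj (charVal φ x) :=
  Circle.coe_inv_eq_conj _

theorem charC_inv (φ : DualGroup A) : charC φ⁻¹ = star (charC φ) := by
  ext x
  exact charVal_inv φ x

variable (A) in
/-- The star subalgebra of `C(A)` generated by the characters. -/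
noncomputable def charSubalgebra : StarSubalgebra ℂ C(A, ℂ) where
  toSubalgebra := Algebra.adjoin ℂ (Set.range charC)
  star_mem' := by
    change Algebra.adjoin ℂ (Set.range (charC (A := A))) ≤
      star (Algebra.adjoin ℂ (Set.range (charC (A := A))))
    refine Algebra.adjoin_le ?_
    rintro - ⟨φ, rfl⟩
    exact Algebra.subset_adjoin ⟨φ⁻¹, charC_inv φ⟩

/-- The characters are closed under products and contain `1`, so generating an algebra adds nothing
beyond their span. -/
theorem charSubalgebra_toSubmodule :
    Subalgebra.toSubmodule (charSubalgebra A).toSubalgebra =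
      Submodule.span ℂ (Set.range (charC (A := A))) := by
  refine Algebra.adjoin_eq_span_of_subset ℂ (Subset.trans ?_ Submodule.subset_span)
  intro x hx
  refine Submonoid.closure_induction (fun _ => id) ⟨1, charC_one⟩ ?_ hx
  rintro - - - - ⟨φ, rfl⟩ ⟨ψ, rfl⟩
  exact ⟨φ * ψ, charC_mul φ ψ⟩

variable [IsTopologicalAddGroup A] [CompactSpace A] [MeasurableSpace A] [BorelSpace A]
  (H : Measure A) [H.IsAddHaarMeasure] [H.Regular] [IsProbabilityMeasure H]

include H in
-- If all characters agree at `x` and `y`, then `T_{x-y}` fixes each of them, hence is the identity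
-- on `L²`. A Urysohn function separating `x` from `y` would then be invariant under `x - y`,
-- everywhere by continuity.
theorem exists_charVal_ne [T2Space A] {x y : A} (hxy : x ≠ y) :
    ∃ φ : DualGroup A, charVal φ x ≠ charVal φ y := by
  by_contra! h
  have hone (φ : DualGroup A) : charVal φ (x - y) = 1 := by
    rw [sub_eq_add_neg, charVal_add, h, ← charVal_add, add_neg_cancel, charVal_zero]
  have hT : translation H (x - y) = ContinuousLinearMap.id ℂ _ := by
    refine ContinuousLinearMap.ext_on (dense_span_charL2 (H := H)) ?_
    rintro _ ⟨φ, rfl⟩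
    rw [translation_charL2, hone, one_smul]
    rfl
  obtain ⟨g, hg0, hg1, -⟩ := exists_continuous_zero_one_of_isClosed (isClosed_singleton (x := x))
    (isClosed_singleton (x := y)) (by simpa using hxy)
  let f : C(A, ℂ) := ⟨fun z => (g z : ℂ), Complex.continuous_ofReal.comp g.continuous⟩
  have hf : (fun z => f (z + (x - y))) =ᵐ[H] f := by
    have h1 := coeFn_translation H (x - y) (ContinuousMap.toLp 2 H ℂ f)
    rw [hT] at h1
    have h2 := ContinuousMap.coeFn_toLp (p := 2) (𝕜 := ℂ) H f
    filter_upwards [h1, h2,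
      (measurePreserving_add_right H (x - y)).quasiMeasurePreserving.ae h2] with z a b c
    rw [← c, ← b]
    exact a.symm
  have hf' := (Continuous.ae_eq_iff_eq H (f.continuous.comp (continuous_add_const (x - y)))
    f.continuous).1 hf
  have h3 : (g x : ℂ) = g y := by simpa [f] using congrFun hf' y
  rw [hg0 rfl, hg1 rfl] at h3
  simp at h3

include H in
theorem dense_span_charC [T2Space A] :
    Dense (Submodule.span ℂ (Set.range (charC (A := A))) : Set C(A, ℂ)) := by
  refine Submodule.dense_iff_topologicalClosure_eq_top.2 ?_
  rw [← charSubalgebra_toSubmodule]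
  refine congrArg (Subalgebra.toSubmodule <| StarSubalgebra.toSubalgebra ·)
    (ContinuousMap.starSubalgebra_topologicalClosure_eq_top_of_separatesPoints
      (charSubalgebra A) fun x y hxy => ?_)
  obtain ⟨φ, hφ⟩ := exists_charVal_ne H hxy
  exact ⟨_, ⟨charC φ, Algebra.subset_adjoin ⟨φ, rfl⟩, rfl⟩, hφ⟩

include H in
theorem clm_eq_zero_of_charC [T2Space A] {E : Type*} [NormedAddCommGroup E] [NormedSpace ℂ E]
    (ℓ : C(A, ℂ) →L[ℂ] E) (h : ∀ φ : DualGroup A, ℓ (star (charC φ)) = 0) : ℓ = 0 := by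
  refine ContinuousLinearMap.ext_on (dense_span_charC H) ?_
  rintro _ ⟨φ, rfl⟩
  rw [← inv_inv φ, charC_inv, h]
  rfl

end Uniform

/-! ### Uniqueness for integrable functions -/

section Uniqueness

/-- With a Urysohn function `g` equal to `1` on `K` and `0` off `U`, the integral over `K` equals
minus that of `θ * g` over `U \ K`. -/
theorem setIntegral_eq_zero_of_forall_continuous {X : Type*} [TopologicalSpace X] [T2Space X]
    [CompactSpace X] [MeasurableSpace X] [BorelSpace X] {H : Measure X} [H.OuterRegular]
    [IsFiniteMeasure H] {θ : X → ℂ} (hθ : Integrable θ H)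
    (h : ∀ g : C(X, ℂ), ∫ x, θ x * g x ∂H = 0) {K : Set X} (hK : IsCompact K) :
    ∫ x in K, θ x ∂H = 0 := by
  by_contra hne
  -- Absolute continuity with threshold the supposedly nonzero integral over `K`: a thin enough `U \
  -- K` then gives a contradiction.
  obtain ⟨δ, hδ, hδθ⟩ := exists_pos_setLIntegral_lt_of_measure_lt (μ := H)
    (f := fun x => ‖θ x‖ₑ) hθ.2.ne (ε := ‖∫ x in K, θ x ∂H‖ₑ) (by simpa using hne)
  obtain ⟨U, hKU, hU, hUK⟩ := hK.measurableSet.exists_isOpen_sdiff_lt (measure_ne_top H K) hδ.ne'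
  obtain ⟨g, hg0, hg1, hg⟩ := exists_continuous_zero_one_of_isClosed hU.isClosed_compl hK.isClosed
    (disjoint_compl_left_iff_subset.2 hKU)
  let f : C(X, ℂ) := ⟨fun z => (g z : ℂ), Complex.continuous_ofReal.comp g.continuous⟩
  have hnorm (x : X) : ‖f x‖ ≤ 1 := by
    change ‖(g x : ℂ)‖ ≤ 1
    rw [Complex.norm_real, Real.norm_of_nonneg (hg x).1]
    exact (hg x).2
  have hfi : Integrable (fun x => θ x * f x) H :=
    hθ.mul_bdd f.continuous.aestronglyMeasurable (ae_of_all _ hnorm)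
  have h1 : ∫ x in K, θ x ∂H = ∫ x in U \ K, -(θ x * f x) ∂H := by
    have h2 : ∫ x in U, θ x * f x ∂H = 0 := by
      rw [setIntegral_eq_integral_of_forall_compl_eq_zero, h f]
      intro x hx
      change θ x * (g x : ℂ) = 0
      rw [hg0 hx]
      simp
    have h3 : ∫ x in K, θ x ∂H = ∫ x in K, θ x * f x ∂H := by
      refine setIntegral_congr_fun hK.measurableSet fun x hx => ?_
      change θ x = θ x * (g x : ℂ)
      rw [hg1 hx]
      simp
    rw [integral_neg, setIntegral_sdiff hK.measurableSet hfi.integrableOn hKU, h2, h3, zero_sub,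
      neg_neg]
  refine (hδθ (U \ K) hUK.2).not_ge ?_
  rw [h1]
  refine (enorm_integral_le_lintegral_enorm _).trans (lintegral_mono fun x => ?_)
  rw [enorm_neg, enorm_mul]
  refine mul_le_of_le_one_right' ?_
  rw [← ofReal_norm]
  exact ENNReal.ofReal_le_one.2 (hnorm x)

variable {A : Type*} [AddCommGroup A] [TopologicalSpace A] [IsTopologicalAddGroup A] [T2Space A]
  [CompactSpace A] [MeasurableSpace A] [BorelSpace A]
  {H : Measure A} [H.IsAddHaarMeasure] [H.Regular] [IsProbabilityMeasure H]

theorem ae_eq_zero_of_fourierFun_eq_zero {θ : A → ℂ} (hθ : Integrable θ H)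
    (h : ∀ φ : DualGroup A, fourierFun H θ φ = 0) : θ =ᵐ[H] 0 := by
  have hi (g : C(A, ℂ)) : Integrable (fun x => θ x * g x) H :=
    hθ.mul_bdd g.continuous.aestronglyMeasurable (ae_of_all _ g.norm_coe_le_norm)
  let ℓ : C(A, ℂ) →L[ℂ] ℂ := LinearMap.mkContinuous
    { toFun := fun g => ∫ x, θ x * g x ∂H
      map_add' := fun f g => by
        simp only [ContinuousMap.add_apply, mul_add]
        exact integral_add (hi f) (hi g)
      map_smul' := fun c g => by
        simp only [ContinuousMap.smul_apply, smul_eq_mul, mul_left_comm _ c, integral_const_mul,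
          RingHom.id_apply] }
    (∫ x, ‖θ x‖ ∂H) fun g => by
      refine (norm_integral_le_of_norm_le (hθ.norm.mul_const ‖g‖) (ae_of_all _ fun x => ?_)).trans
        (integral_mul_const _ _).le
      rw [norm_mul]
      exact mul_le_mul_of_nonneg_left (g.norm_coe_le_norm x) (norm_nonneg _)
  have hℓ : ℓ = 0 := clm_eq_zero_of_charC H ℓ h
  refine ae_eq_zero_of_forall_setIntegral_isCompact_eq_zero hθ fun K hK =>
    setIntegral_eq_zero_of_forall_continuous hθ (fun g => ?_) hK
  exact DFunLike.congr_fun hℓ g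

end Uniqueness

/-! ### Uniqueness for complex measures -/

section Measures

variable {X : Type*} [MeasurableSpace X]

/-- The integral is built from a real bilinear pairing; complex homogeneity comes from associativity
of multiplication. -/
theorem vectorMeasure_integral_const_mul (μ : ComplexMeasure X) (c : ℂ) (f : X → ℂ) :
    VectorMeasure.integral μ (fun x => c * f x) (ContinuousLinearMap.mul ℝ ℂ) =
      c * VectorMeasure.integral μ f (ContinuousLinearMap.mul ℝ ℂ) :=
  setToFun_smul (𝕜 := ℂ) _ (fun c s x => mul_assoc c x (μ s)) c f

theorem vectorMeasure_integral_indicator_one (μ : ComplexMeasure X) [IsFiniteMeasure μ.variation]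
    {s : Set X} (hs : MeasurableSet s) :
    VectorMeasure.integral μ (s.indicator fun _ => (1 : ℂ)) (ContinuousLinearMap.mul ℝ ℂ) = μ s := by
  rw [VectorMeasure.integral_eq_setToFun, setToFun_indicator_const _ hs (measure_ne_top _ _)]
  exact one_mul _

/-- Regularity makes indicators `L¹`-limits of continuous functions for the variation, which bounds
the integral against `μ`. -/
theorem complexMeasure_eq_zero_of_forall_continuous [TopologicalSpace X] [T2Space X]
    [CompactSpace X] [BorelSpace X] (μ : ComplexMeasure X) [μ.variation.Regular]
    (h : ∀ g : C(X, ℂ), VectorMeasure.integral μ g (ContinuousLinearMap.mul ℝ ℂ) = 0) : μ = 0 := by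
  refine VectorMeasure.ext fun s hs => ?_
  rw [zero_apply, ← vectorMeasure_integral_indicator_one μ hs, ← norm_le_zero_iff]
  refine le_of_forall_pos_le_add fun ε hε => ?_
  have hsi : Integrable (s.indicator fun _ => (1 : ℂ)) μ.variation :=
    (integrable_const 1).indicator hs
  obtain ⟨g, -, hg, hgc, hgi⟩ := hsi.exists_hasCompactSupport_integral_sub_le hε
  have h1 := VectorMeasure.integral_fun_sub (B := ContinuousLinearMap.mul ℝ ℂ) hsi hgi
  have h2 : VectorMeasure.integral μ g (ContinuousLinearMap.mul ℝ ℂ) = 0 := h ⟨g, hgc⟩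
  rw [h2, sub_zero] at h1
  rw [← h1, zero_add]
  refine VectorMeasure.norm_integral_le_integral_norm.trans ?_
  refine (mul_le_of_le_one_left (integral_nonneg fun _ => norm_nonneg _)
    (ContinuousLinearMap.opNorm_mul_le ℝ ℂ)).trans hg

variable {A : Type*} [AddCommGroup A] [TopologicalSpace A] [IsTopologicalAddGroup A] [T2Space A]
  [CompactSpace A] [MeasurableSpace A] [BorelSpace A]
  (H : Measure A) [H.IsAddHaarMeasure] [H.Regular] [IsProbabilityMeasure H]

include H in
theorem eq_zero_of_fourierMeasure_eq_zero (μ : ComplexMeasure A) [μ.variation.Regular]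
    (h : ∀ φ : DualGroup A, fourierMeasure μ φ = 0) : μ = 0 := by
  have hi (g : C(A, ℂ)) : Integrable g μ.variation :=
    g.continuous.integrable_of_hasCompactSupport (HasCompactSupport.of_compactSpace g)
  let ℓ : C(A, ℂ) →L[ℂ] ℂ := LinearMap.mkContinuous
    { toFun := fun g => VectorMeasure.integral μ g (ContinuousLinearMap.mul ℝ ℂ)
      map_add' := fun f g => VectorMeasure.integral_fun_add (hi f) (hi g)
      map_smul' := fun c g => vectorMeasure_integral_const_mul μ c g }
    (‖ContinuousLinearMap.mul ℝ ℂ‖ * μ.variation.real univ) fun g => by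
      refine (VectorMeasure.norm_integral_le_of_norm_le_const
        (ae_of_all _ g.norm_coe_le_norm)).trans_eq (by ring)
  -- The values of `ℓ` at conjugate characters are by definition the Fourier coefficients of `μ`;
  -- `H` enters only through the density of the characters.
  have hℓ : ℓ = 0 := clm_eq_zero_of_charC H ℓ h
  exact complexMeasure_eq_zero_of_forall_continuous μ fun g => DFunLike.congr_fun hℓ g

end Measures

end CompactFourier

theorem mainTheorem3 {A : Type*} [AddCommGroup A] [TopologicalSpace A] [IsTopologicalAddGroup A]
    [T2Space A] [CompactSpace A] [MeasurableSpace A] [BorelSpace A]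
    (H : Measure A) [H.IsAddHaarMeasure] [H.Regular] [IsProbabilityMeasure H] :
    -- translations: unitary, and multiplication of characters by their values
    (∀ a : A, CompactFourier.translation H a ∈ unitary (Lp ℂ 2 H →L[ℂ] Lp ℂ 2 H)) ∧
    (∀ (a : A) (φ : CompactFourier.DualGroup A),
      CompactFourier.translation H a (CompactFourier.charL2 H φ) =
        CompactFourier.charVal φ a • CompactFourier.charL2 H φ) ∧
    -- the convolution operators
    (∃ C : (A → ℂ) → (Lp ℂ 2 H →L[ℂ] Lp ℂ 2 H),
      ∀ θ : A → ℂ, Integrable θ H →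
        -- `C θ` is convolution by `θ`, with norm at most the `L¹` norm of `θ`
        (∀ f : Lp ℂ 2 H,
          (∀ᵐ x ∂H, ConvolutionExistsAt θ f x (ContinuousLinearMap.mul ℂ ℂ) H) ∧
          C θ f =ᵐ[H] CompactFourier.conv H θ f) ∧
        ‖C θ‖ ≤ ∫ x, ‖θ x‖ ∂H ∧
        -- the adjoint is again a convolution operator
        ContinuousLinearMap.adjoint (C θ) = C (fun x => conj (θ (-x))) ∧
        -- compact and normal
        C θ ∈ closure {F : Lp ℂ 2 H →L[ℂ] Lp ℂ 2 H |
          FiniteDimensional ℂ (LinearMap.range (F : Lp ℂ 2 H →ₗ[ℂ] Lp ℂ 2 H))} ∧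
        IsCompactOperator (C θ) ∧
        IsStarNormal (C θ) ∧
        -- an orthonormal basis of eigenvectors
        (∃ (s : Set (Lp ℂ 2 H)) (b : HilbertBasis s ℂ (Lp ℂ 2 H)),
          ∀ v : s, b v = v ∧ ∃ l : ℂ, C θ (v : Lp ℂ 2 H) = l • (v : Lp ℂ 2 H)) ∧
        -- translations commute with `C θ` and preserve its eigenspaces
        (∀ a : A, Commute (CompactFourier.translation H a) (C θ)) ∧
        (∀ (a : A) (l : ℂ),
          (Module.End.eigenspace (C θ : Lp ℂ 2 H →ₗ[ℂ] Lp ℂ 2 H) l).map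
              (CompactFourier.translation H a : Lp ℂ 2 H →ₗ[ℂ] Lp ℂ 2 H) =
            Module.End.eigenspace (C θ : Lp ℂ 2 H →ₗ[ℂ] Lp ℂ 2 H) l) ∧
        -- characters are eigenvectors, with the Fourier coefficients of `θ` as eigenvalues
        (∀ φ : CompactFourier.DualGroup A,
          C θ (CompactFourier.charL2 H φ) =
            CompactFourier.fourierFun H θ φ • CompactFourier.charL2 H φ) ∧
        -- eigenspaces of nonzero eigenvalues: finite-dimensional, with an orthonormal basis
        -- of characters
        (∀ l : ℂ, l ≠ 0 →
          FiniteDimensional ℂ (Module.End.eigenspace (C θ : Lp ℂ 2 H →ₗ[ℂ] Lp ℂ 2 H) l) ∧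
          ∃ (s : Finset (CompactFourier.DualGroup A))
            (b : OrthonormalBasis s ℂ
              (Module.End.eigenspace (C θ : Lp ℂ 2 H →ₗ[ℂ] Lp ℂ 2 H) l)),
            ∀ φ : s, (b φ : Lp ℂ 2 H) = CompactFourier.charL2 H (φ : CompactFourier.DualGroup A))) ∧
    -- simultaneous eigenfunctions of the translations are multiples of characters
    (∀ (f : Lp ℂ 2 H) (m : A → ℂ), f ≠ 0 → (∀ a, CompactFourier.translation H a f = m a • f) →
      ∃ φ : CompactFourier.DualGroup A, (∀ a, m a = CompactFourier.charVal φ a) ∧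
        ∃ c : ℂ, f = c • CompactFourier.charL2 H φ) ∧
    -- the characters form an orthonormal basis of `L²(A)`
    (∃ b : HilbertBasis (CompactFourier.DualGroup A) ℂ (Lp ℂ 2 H),
      ∀ φ, b φ = CompactFourier.charL2 H φ) ∧
    -- finite linear combinations of characters are uniformly dense in `C(A)`
    Dense (Submodule.span ℂ (Set.range (CompactFourier.charC (A := A))) : Set C(A, ℂ)) ∧
    -- uniqueness of Fourier coefficients for integrable functions
    (∀ θ : A → ℂ, Integrable θ H →
      (∀ φ : CompactFourier.DualGroup A, CompactFourier.fourierFun H θ φ = 0) → θ =ᵐ[H] 0) ∧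
    -- and for regular complex Borel measures
    (∀ μ : ComplexMeasure A, μ.variation.Regular →
      (∀ φ : CompactFourier.DualGroup A, CompactFourier.fourierMeasure μ φ = 0) → μ = 0) := by
  refine ⟨CompactFourier.translation_mem_unitary H, CompactFourier.translation_charL2 H,
    ⟨CompactFourier.convOp H, fun θ hθ => ⟨fun f => ⟨?_, CompactFourier.convOp_ae_eq_conv hθ f⟩,
      CompactFourier.norm_convOp_le hθ, CompactFourier.adjoint_convOp hθ,
      CompactFourier.convOp_mem_finiteRankClosure hθ, CompactFourier.isCompactOperator_convOp hθ,
      CompactFourier.isStarNormal_convOp hθ, CompactFourier.exists_hilbertBasis_eigenvectors hθ,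
      CompactFourier.commute_translation_convOp hθ, CompactFourier.map_translation_eigenspace hθ,
      CompactFourier.convOp_charL2 hθ, fun l hl => ?_⟩⟩,
    fun f m hf h => CompactFourier.exists_charVal_of_translation_eq_smul hf h,
    CompactFourier.exists_hilbertBasis_charL2, CompactFourier.dense_span_charC H,
    fun θ hθ h => CompactFourier.ae_eq_zero_of_fourierFun_eq_zero hθ h,
    fun μ _ h => CompactFourier.eq_zero_of_fourierMeasure_eq_zero H μ h⟩
  · exact CompactFourier.ae_convolutionExistsAt hθ ((Lp.memLp f).integrable one_le_two)
  · have := CompactFourier.finiteDimensional_eigenspace_convOp hθ hl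
    exact ⟨this, CompactFourier.exists_orthonormalBasis_charL2 _ fun a f hf =>
      CompactFourier.translation_mem_eigenspace hθ l a hf⟩
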